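/- For $n>0$ let $G_3(n)$ be the graph whose vertices are the one-element subsets (singletons) and three-element subsets (tripletons) of an $n$-element set, two different vertices being adjacent when one of the subsets contains the other. A drawing of a graph in three layers places its vertices at distinct points of the Euclidean plane, represents each edge by the straight line segment between its endpoints, and partitions the edges into three layers so that two different edges in the same layer do not cross, i.e. their segments have no point in common other than the point of a common end vertex. A convex drawing of $G_3(n)$ is a drawing in three layers in which the singletons are in (strictly) convex position. Number the singletons of a convex drawing $0,\dots,n-1$ in clockwise order, starting from an arbitrary one; an edge from a tripleton to its singleton with the smallest, the largest, or the remaining number is called low, high, or middle, respectively. A coherent drawing is a convex drawing whose three layers are the low, the middle and the high edges (for some such numbering). An inner drawing is a coherent drawing for which there is a strictly convex closed curve $C$ such that all singletons lie on $C$ and all tripletons lie in the interior of $C$. Then there exists a positive integer $n_3$ such that $G_3(n_3)$ does not have an inner drawing. -/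

import Mathlib

/-- The Euclidean plane, where the drawings live. -/
abbrev Plane : Type := EuclideanSpace ℝ (Fin 2)

/-- The vertices of `G₃(n)`: the one-element and the three-element subsets of `Fin n`. -/
abbrev G3Vertex (n : ℕ) : Type := {s : Finset (Fin n) // s.card = 1 ∨ s.card = 3}

/-- The singleton vertex `{i}`. -/
def single {n : ℕ} (i : Fin n) : G3Vertex n := ⟨{i}, Or.inl (Finset.card_singleton i)⟩

/-- The graph `G₃(n)`: two different vertices are joined when one of the two subsets is contained
in the other. -/
def G3 (n : ℕ) : SimpleGraph (G3Vertex n) where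
  Adj s t := s ≠ t ∧ (s.1 ⊆ t.1 ∨ t.1 ⊆ s.1)
  symm := ⟨fun _ _ h => ⟨h.1.symm, h.2.symm⟩⟩
  loopless := ⟨fun _ h => h.1 rfl⟩

/-- The straight line segment that represents the edge `e` when the vertices are placed
by `pos`. -/
def edgeSegment {V : Type*} (pos : V → Plane) (e : Sym2 V) : Set Plane :=
  convexHull ℝ (pos '' {v | v ∈ e})

/-- `pos` and `layer` form a straight-line drawing of `G` in `k` layers: vertices are placed at
distinct points, the layers partition the edges, and two different edges in the same layer
do not cross, i.e. their segments meet at most in the point of a common end vertex. -/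
structure IsLayeredDrawing {V : Type*} (G : SimpleGraph V) {k : ℕ} (pos : V → Plane)
    (layer : Fin k → Set (Sym2 V)) : Prop where
  injective : Function.Injective pos
  iUnion_layer : ⋃ i, layer i = G.edgeSet
  disjoint_layer : ∀ i j, i ≠ j → Disjoint (layer i) (layer j)
  noncrossing : ∀ i, ∀ e ∈ layer i, ∀ f ∈ layer i, e ≠ f →
    edgeSegment pos e ∩ edgeSegment pos f ⊆ pos '' {v | v ∈ e ∧ v ∈ f}

/-- A convex drawing of `G₃(n)`: a drawing in three layers with the singletons in (strictly) convex
position. The tripletons are not restricted. -/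
structure IsConvexDrawing {n : ℕ} (pos : G3Vertex n → Plane)
    (layer : Fin 3 → Set (Sym2 (G3Vertex n))) : Prop
    extends IsLayeredDrawing (G3 n) pos layer where
  convexPosition : ConvexIndependent ℝ (fun i : Fin n => pos (single i))

/-- The points `a`, `b`, `c` are the vertices of a non-degenerate triangle, in clockwise order:
the cross product of `b - a` and `c - a` is negative. -/
def Clockwise (a b c : Plane) : Prop :=
  (b 0 - a 0) * (c 1 - a 1) - (b 1 - a 1) * (c 0 - a 0) < 0

/-- `num` numbers the singletons from `0` to `n - 1` in clockwise order (for points in convex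
position: any three of them, taken by increasing numbers, are in clockwise order). The vertex with
number `0` is arbitrary. -/
def IsClockwiseNumbering {n : ℕ} (pos : G3Vertex n → Plane) (num : Fin n ≃ Fin n) : Prop :=
  ∀ i j k : Fin n, num i < num j → num j < num k →
    Clockwise (pos (single i)) (pos (single j)) (pos (single k))

/-- The low edges: from a tripleton to its singleton with the smallest number. -/
def lowEdges {n : ℕ} (num : Fin n ≃ Fin n) : Set (Sym2 (G3Vertex n)) :=
  {e | ∃ (i : Fin n) (t : G3Vertex n), t.1.card = 3 ∧ i ∈ t.1 ∧ e = s(single i, t) ∧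
    ∀ j ∈ t.1, num i ≤ num j}

/-- The high edges: from a tripleton to its singleton with the largest number. -/
def highEdges {n : ℕ} (num : Fin n ≃ Fin n) : Set (Sym2 (G3Vertex n)) :=
  {e | ∃ (i : Fin n) (t : G3Vertex n), t.1.card = 3 ∧ i ∈ t.1 ∧ e = s(single i, t) ∧
    ∀ j ∈ t.1, num j ≤ num i}

/-- The middle edges: from a tripleton to its remaining singleton. -/
def middleEdges {n : ℕ} (num : Fin n ≃ Fin n) : Set (Sym2 (G3Vertex n)) :=
  {e | ∃ (i : Fin n) (t : G3Vertex n), t.1.card = 3 ∧ i ∈ t.1 ∧ e = s(single i, t) ∧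
    (∃ j ∈ t.1, num j < num i) ∧ (∃ k ∈ t.1, num i < num k)}

/-- A coherent drawing of `G₃(n)`: a convex drawing whose three layers are the low, the middle and
the high edges, for some clockwise numbering of the singletons. -/
def IsCoherentDrawing {n : ℕ} (pos : G3Vertex n → Plane) : Prop :=
  ∃ num : Fin n ≃ Fin n, IsClockwiseNumbering pos num ∧
    IsConvexDrawing pos ![lowEdges num, middleEdges num, highEdges num]

/-- `C` is a strictly convex (closed) curve with interior region `U`: the boundary and the interior
of a compact strictly convex set with non-empty interior. -/
def IsStrictlyConvexCurve (C U : Set Plane) : Prop :=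
  ∃ K : Set Plane, IsCompact K ∧ StrictConvex ℝ K ∧ (interior K).Nonempty ∧
    C = frontier K ∧ U = interior K

/-- An inner drawing of `G₃(n)`: a coherent drawing such that, for some strictly convex curve,
all singletons lie on the curve and all tripletons lie in its interior. -/
def IsInnerDrawing {n : ℕ} (pos : G3Vertex n → Plane) : Prop :=
  IsCoherentDrawing pos ∧ ∃ C U : Set Plane, IsStrictlyConvexCurve C U ∧
    (∀ i : Fin n, pos (single i) ∈ C) ∧ (∀ t : G3Vertex n, t.1.card = 3 → pos t ∈ U)

/-!
A large inner drawing contains a highly regular one, and a regular one with thirteen singletons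
violates the non-crossing condition on very few edges.

*Regularity.* Ramsey's theorem (`exists_homogeneous_orderEmbedding`), applied to the quintuples of
singletons, gives thirteen singletons for which the side of the chord `ab` that contains the tripleton
`ijk` only depends on the relative order of `a`, `b`, `i`, `j`, `k`.

*Geometry.* The strictly convex curve is used only through the supporting line at each singleton `p`:
all other points are seen from `p` within an open half-plane, so that "clockwise as seen from `p`" is a
transitive relation (`orient_pos_trans`). For tripletons `t`, `u` the sign of `orient p t u` says on
which side of the line `tu` the singleton `p` lies. There are two sources of information on it: a chord
between `t` and `u` fixes the sign at both of its ends (`IsConvexFrame.orient_of_chord`), and two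
non-crossing edges of a layer from neighbouring singletons fix it for one of these
(`IsConvexFrame.orient_nonpos_or_of_disjoint`). On the other hand the signs at four singletons cannot
alternate (`IsConvexFrame.not_alternating`), since a line meets the curve at most twice.

*Contradiction* (`IsConvexFrame.false_of_homogeneous`). If the tripletons are always close to their
first, middle or last singleton, then edges of another layer cross like chords
(`IsConvexFrame.not_disjoint_of_caps`). If they are all close to the point of the curve where the
numbering starts, then the edges of `ijk` and `i'j'k'` with `i < i' < j' < j < k < k'` are incompatible:
the low and the high edges force the second tripleton to one side of the first, the middle edges to the
other. Otherwise a tripleton lies, in a combinatorial sense, inside the triangle formed by three of the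
points `i`, `j`, `k` and the starting point; in each of the four cases the signs for one suitable pair of
interleaved triples alternate four times.
-/

/-! ### Ramsey's theorem -/

open Finset in
/-- **Ramsey's theorem** for colourings of the `r`-element subsets with finitely many colours. -/
theorem exists_homogeneous_finset {κ : Type} [Finite κ] (r : ℕ) : ∀ m : ℕ, ∃ N : ℕ,
    ∀ {α : Type} [LinearOrder α] (c : Finset α → κ) (S : Finset α), N ≤ #S →
      ∃ H ⊆ S, #H = m ∧ ∃ k, ∀ e ⊆ H, #e = r → c e = k := by
  classical
  induction r with
  | zero =>
    refine fun m => ⟨m, fun c S hS => ?_⟩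
    obtain ⟨H, hHS, hH⟩ := exists_subset_card_eq hS
    exact ⟨H, hHS, hH, c ∅, fun e _ he => by rw [card_eq_zero.1 he]⟩
  | succ r ih =>
    -- Large sets contain an `l`-element set on which the colour only depends on the minimum.
    have key : ∀ l : ℕ, ∃ N : ℕ, ∀ {α : Type} [LinearOrder α] (c : Finset α → κ) (S : Finset α),
        N ≤ #S → ∃ H ⊆ S, #H = l ∧ ∃ d : α → κ, ∀ e ⊆ H, #e = r + 1 →
          ∀ x ∈ e, (∀ y ∈ e, x ≤ y) → c e = d x := by
      intro l
      induction l with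
      | zero =>
        refine ⟨0, fun c S _ => ⟨∅, empty_subset _, rfl, fun _ => c ∅, fun e he hc => ?_⟩⟩
        simp [subset_empty.1 he] at hc
      | succ l ihl =>
        obtain ⟨N, hN⟩ := ihl
        obtain ⟨M, hM⟩ := ih N
        refine ⟨M + 1, fun c S hS => ?_⟩
        have hne : S.Nonempty := card_pos.1 (by omega)
        set x := S.min' hne with hx
        obtain ⟨H, hHS, hH, k, hk⟩ := hM (fun e => c (insert x e)) (S.erase x)
          (by rw [card_erase_of_mem (min'_mem S hne)]; omega)
        obtain ⟨A, hAH, hA, d, hd⟩ := hN c H hH.ge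
        have hlt : ∀ y ∈ A, x < y := fun y hy =>
          min'_lt_of_mem_erase_min' _ _ (hHS (hAH hy))
        have hxA : x ∉ A := fun h => lt_irrefl _ (hlt x h)
        refine ⟨insert x A, ?_, by rw [card_insert_of_notMem hxA, hA],
          fun y => if y = x then k else d y, fun e he hc y hy hmin => ?_⟩
        · intro y hy
          rcases mem_insert.1 hy with rfl | hy
          · exact min'_mem S hne
          · exact mem_of_mem_erase (hHS (hAH hy))
        · dsimp only
          by_cases hxe : x ∈ e
          · have hyx : y = x := by
              rcases mem_insert.1 (he hy) with h | h
              · exact h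
              · exact absurd (hmin x hxe) (not_le.2 (hlt y h))
            rw [if_pos hyx]
            have := hk (e.erase x) ((subset_insert_iff.1 he).trans hAH)
              (by rw [card_erase_of_mem hxe, hc]; rfl)
            rwa [insert_erase hxe] at this
          · rw [if_neg (fun h : y = x => hxe (h ▸ hy))]
            exact hd e ((subset_insert_iff_of_notMem hxe).1 he) hc y hy hmin
    intro m
    cases nonempty_fintype κ
    obtain ⟨N, hN⟩ := key (Fintype.card κ * m)
    refine ⟨N + 1, fun c S hS => ?_⟩
    obtain ⟨A, hAS, hA, d, hd⟩ := hN c S (by omega)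
    -- A majority colour of the minima.
    have : Nonempty κ := ⟨c ∅⟩
    obtain ⟨k, -, hk⟩ := exists_le_card_fiber_of_mul_le_card_of_maps_to
      (s := A) (t := (univ : Finset κ)) (f := d) (n := m) (fun _ _ => mem_univ _) univ_nonempty
      (by rw [hA, card_univ])
    obtain ⟨H, hHA, hH⟩ := exists_subset_card_eq hk
    refine ⟨H, hHA.trans ((filter_subset _ _).trans hAS), hH, k, fun e he hc => ?_⟩
    have hne : e.Nonempty := card_pos.1 (by omega)
    have hm := min'_mem e hne
    rw [hd e (he.trans (hHA.trans (filter_subset _ _))) hc _ hm fun y hy => min'_le _ _ hy]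
    exact (mem_filter.1 (hHA (he hm))).2

/-- Ramsey's theorem for increasing `r`-tuples. -/
theorem exists_homogeneous_orderEmbedding {κ : Type} [Finite κ] (r m : ℕ) : ∃ N : ℕ, 0 < N ∧
    ∀ c : (Fin r → Fin N) → κ, ∃ g : Fin m ↪o Fin N, ∃ k, ∀ x : Fin r → Fin m,
      StrictMono x → c (g ∘ x) = k := by
  classical
  obtain ⟨N, hN⟩ := exists_homogeneous_finset (κ := κ) r m
  refine ⟨N + 1, N.succ_pos, fun c => ?_⟩
  -- An `r`-element set is coloured by the increasing tuple of its elements.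
  obtain ⟨H, -, hH, k, hk⟩ := hN (fun e : Finset (Fin (N + 1)) =>
    c (fun l => if h : e.card = r then e.orderEmbOfFin h l else 0)) Finset.univ (by simp)
  refine ⟨H.orderEmbOfFin hH, k, fun x hx => ?_⟩
  have hy : StrictMono (H.orderEmbOfFin hH ∘ x) := (H.orderEmbOfFin hH).strictMono.comp hx
  have hcard : (Finset.univ.image (H.orderEmbOfFin hH ∘ x)).card = r := by
    rw [Finset.card_image_of_injective _ hy.injective, Finset.card_fin]
  rw [← hk (Finset.univ.image (H.orderEmbOfFin hH ∘ x)) _ hcard]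
  · congr 1
    funext l
    rw [dif_pos hcard]
    exact congrFun (Finset.orderEmbOfFin_unique hcard
      (fun l => Finset.mem_image_of_mem _ (Finset.mem_univ l)) hy) l
  · intro y hy
    obtain ⟨l, -, rfl⟩ := Finset.mem_image.1 hy
    exact Finset.orderEmbOfFin_mem H hH _

/-! ### Orientation of point triples in the plane -/

/-- Twice the signed area of the triangle `a b c`; positive when `a`, `b`, `c` are in clockwise
order. -/
def orient (a b c : Plane) : ℝ :=
  (b 1 - a 1) * (c 0 - a 0) - (b 0 - a 0) * (c 1 - a 1)

theorem clockwise_iff_orient_pos {a b c : Plane} : Clockwise a b c ↔ 0 < orient a b c := by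
  unfold Clockwise orient
  constructor <;> intro h <;> linarith

theorem orient_rotate (a b c : Plane) : orient b c a = orient a b c := by
  unfold orient; ring

theorem orient_swap_left (a b c : Plane) : orient b a c = -orient a b c := by
  unfold orient; ring

theorem orient_swap_right (a b c : Plane) : orient a c b = -orient a b c := by
  unfold orient; ring

/-- Seen from `p`, the points `u`, `v`, `w` lie in an open half-plane bounded by a line through `p`;
there, turning clockwise is a transitive relation. -/
theorem orient_pos_trans {p u v w : Plane} (φ : Plane →L[ℝ] ℝ) (hu : φ u < φ p) (hv : φ v < φ p)
    (hw : φ w < φ p) (huv : 0 ≤ orient p u v) (hvw : 0 ≤ orient p v w)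
    (h : 0 < orient p u v ∨ 0 < orient p v w) : 0 < orient p u w := by
  have hφ : ∀ x : Plane, φ x = x 0 * φ (EuclideanSpace.single 0 1)
      + x 1 * φ (EuclideanSpace.single 1 1) := by
    intro x
    have hx : x = x 0 • EuclideanSpace.single (0 : Fin 2) (1 : ℝ)
        + x 1 • EuclideanSpace.single (1 : Fin 2) (1 : ℝ) := by
      ext i; fin_cases i <;> simp
    conv_lhs => rw [hx]
    simp
  have key : (φ p - φ v) * orient p u w
      = (φ p - φ w) * orient p u v + (φ p - φ u) * orient p v w := by
    rw [hφ p, hφ u, hφ v, hφ w]; unfold orient; ring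
  have : 0 < (φ p - φ w) * orient p u v + (φ p - φ u) * orient p v w := by
    rcases h with h | h
    · have := mul_pos (sub_pos.2 hw) h
      have := mul_nonneg (sub_pos.2 hu).le hvw
      linarith
    · have := mul_nonneg (sub_pos.2 hw).le huv
      have := mul_pos (sub_pos.2 hu) h
      linarith
  rw [← key] at this
  exact pos_of_mul_pos_right this (sub_pos.2 hv).le

/-- A sufficient condition for the segments `a t` and `b u` to cross: the points `a`, `b`, `t`, `u`
are the vertices of a convex quadrilateral, in this order. -/
theorem not_disjoint_segment_of_orient_pos {a b t u : Plane} (h₁ : 0 < orient a b t)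
    (h₂ : 0 < orient a b u) (h₃ : 0 < orient a t u) (h₄ : 0 < orient b t u) :
    ¬ Disjoint (segment ℝ a t) (segment ℝ b u) := by
  rw [Set.not_disjoint_iff]
  -- The two diagonals meet where the affine dependence of the four vertices says.
  set s := orient b t u + orient a b u with hs
  have hs0 : 0 < s := by positivity
  have hs' : s = orient a t u + orient a b t := by rw [hs]; unfold orient; ring
  refine ⟨(orient b t u / s) • a + (orient a b u / s) • t,
    ⟨_, _, by positivity, by positivity, by rw [← add_div, div_self hs0.ne'], rfl⟩,
    ⟨orient a t u / s, orient a b t / s, by positivity, by positivity,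
      by rw [← add_div, ← hs', div_self hs0.ne'], ?_⟩⟩
  ext i
  simp only [PiLp.add_apply, PiLp.smul_apply, smul_eq_mul]
  rw [div_mul_eq_mul_div, div_mul_eq_mul_div, div_mul_eq_mul_div, div_mul_eq_mul_div,
    ← add_div, ← add_div]
  congr 1
  unfold orient
  fin_cases i <;> simp <;> ring

/-! ### Points seen from a convex curve -/

/-- The points `P i` are in clockwise convex position and each of them can be separated by a line
from the others and from `U`: the situation of singletons `P i` on a strictly convex curve
with interior `U`. -/
structure IsConvexFrame {ι : Type*} [LinearOrder ι] (P : ι → Plane) (U : Set Plane) : Prop where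
  orient_pos : ∀ ⦃i j k⦄, i < j → j < k → 0 < orient (P i) (P j) (P k)
  exists_support : ∀ i, ∃ φ : Plane →L[ℝ] ℝ, (∀ j, j ≠ i → φ (P j) < φ (P i)) ∧
    ∀ u ∈ U, φ u < φ (P i)

namespace IsConvexFrame

variable {ι : Type*} [LinearOrder ι] {P : ι → Plane} {U : Set Plane} {t u : Plane}

/-- If the chord from `P x` to `P y` has `t` on its left and `u` on its right, then the line from
`t` to `u` has `P x` on its right and `P y` on its left. -/
theorem orient_of_chord (hF : IsConvexFrame P U) (ht : t ∈ U) (hu : u ∈ U) {x y : ι} (hxy : x ≠ y)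
    (h₁ : orient (P x) (P y) t ≤ 0) (h₂ : 0 < orient (P x) (P y) u) :
    0 < orient (P x) t u ∧ orient (P y) t u < 0 := by
  obtain ⟨φ, hφ, hφU⟩ := hF.exists_support x
  obtain ⟨ψ, hψ, hψU⟩ := hF.exists_support y
  constructor
  · refine orient_pos_trans φ (hφU t ht) (hφ y hxy.symm) (hφU u hu) ?_ h₂.le (.inr h₂)
    rw [orient_swap_right]; linarith
  · have h₃ : 0 < orient (P y) u (P x) := by rwa [orient_rotate]
    have := orient_pos_trans ψ (hψU u hu) (hψ x hxy) (hψU t ht) h₃.le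
      (by rw [orient_swap_left]; linarith) (.inl h₃)
    rw [orient_swap_right] at this
    linarith

/-- If `t` lies beyond the chord from `P b` to `P c`, then from any `P x` elsewhere on the curve it
is seen between `P b` and `P c`. -/
theorem orient_of_cap (hF : IsConvexFrame P U) (ht : t ∈ U) {x b c : ι}
    (hxb : x ≠ b) (hbc : b ≠ c) (hxc : x ≠ c)
    (h : 0 < orient (P x) (P b) (P c)) (hcap : orient (P b) (P c) t ≤ 0) :
    0 < orient (P x) (P b) t ∧ 0 < orient (P x) t (P c) := by
  obtain ⟨φ, hφ, hφU⟩ := hF.exists_support b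
  obtain ⟨ψ, hψ, hψU⟩ := hF.exists_support c
  constructor
  · rw [← orient_rotate] at h
    have := orient_pos_trans φ (hφU t ht) (hφ c hbc.symm) (hφ x hxb)
      (by rw [orient_swap_right]; linarith) h.le (.inr h)
    rwa [orient_rotate] at this
  · have h' : 0 < orient (P c) (P x) (P b) := by rwa [← orient_rotate]
    have := orient_pos_trans ψ (hψ x hxc) (hψ b hbc) (hψU t ht) h'.le
      (by rw [orient_swap_left]; linarith) (.inl h')
    rwa [← orient_rotate] at this

/-- If a point of `U` is on the right of a chord, it is on the right of each chord that cuts off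
a smaller part of the curve. -/
theorem orient_pos_mono (hF : IsConvexFrame P U) (ht : t ∈ U) {y x x' w : ι} (hyx : y < x)
    (hxx' : x < x') (hxw : x' < w) (h : 0 < orient (P y) (P w) t) :
    0 < orient (P x) (P x') t := by
  obtain ⟨φ, hφ, hφU⟩ := hF.exists_support y
  obtain ⟨ψ, hψ, hψU⟩ := hF.exists_support x'
  have hyx' := hyx.trans hxx'
  have h₁ : 0 < orient (P y) (P x') t :=
    orient_pos_trans φ (hφ x' hyx'.ne') (hφ w (hyx'.trans hxw).ne') (hφU t ht)
      (hF.orient_pos hyx' hxw).le h.le (.inr h)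
  have h₂ : 0 < orient (P x') (P y) (P x) := by
    rw [← orient_rotate]
    exact hF.orient_pos hyx hxx'
  rw [← orient_rotate] at h₁ ⊢
  exact orient_pos_trans ψ (hψU t ht) (hψ y hyx'.ne) (hψ x hxx'.ne) h₁.le h₂.le (.inl h₁)

/-- Two edges of a layer that start at neighbouring points of the curve, on the same side of the
line from `t` to `u`, would cross if they were in the wrong order along this line. -/
theorem orient_nonpos_or_of_disjoint (hF : IsConvexFrame P U) (ht : t ∈ U) (hu : u ∈ U)
    {y x x' w : ι} (hyx : y < x) (hxx' : x < x') (hxw : x' < w) (h₁ : 0 < orient (P y) (P w) t)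
    (h₂ : 0 < orient (P y) (P w) u) (hd : Disjoint (segment ℝ (P x) t) (segment ℝ (P x') u)) :
    orient (P x) t u ≤ 0 ∨ orient (P x') t u ≤ 0 := by
  by_contra! h
  exact not_disjoint_segment_of_orient_pos (hF.orient_pos_mono ht hyx hxx' hxw h₁)
    (hF.orient_pos_mono hu hyx hxx' hxw h₂) h.1 h.2 hd

/-- If `t` and `u` lie beyond the adjacent chords `P b`, `P m` and `P m`, `P c`, then edges to them
from `P x` and `P x'` cross when `x`, `x'`, `b`, `m`, `c` are in clockwise order. -/
theorem not_disjoint_of_caps (hF : IsConvexFrame P U) (ht : t ∈ U) (hu : u ∈ U) {x x' b m c : ι}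
    (hd : [x, x', b, m, c].Nodup) (h₁ : 0 < orient (P x) (P x') (P b))
    (h₂ : 0 < orient (P x) (P b) (P m)) (h₃ : 0 < orient (P x) (P m) (P c))
    (h₄ : 0 < orient (P x') (P b) (P m)) (h₅ : 0 < orient (P x') (P m) (P c))
    (hbm : orient (P b) (P m) t ≤ 0) (hmc : orient (P m) (P c) u ≤ 0) :
    ¬ Disjoint (segment ℝ (P x) t) (segment ℝ (P x') u) := by
  simp only [List.nodup_cons, List.mem_cons, List.not_mem_nil, or_false, not_or] at hd
  obtain ⟨⟨hxx', hxb, hxm, hxc⟩, ⟨hx'b, hx'm, hx'c⟩, ⟨hbm', -⟩, hmc', -⟩ := hd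
  obtain ⟨φ, hφ, hφU⟩ := hF.exists_support x
  obtain ⟨ψ, hψ, hψU⟩ := hF.exists_support x'
  obtain ⟨k₁, k₂⟩ := hF.orient_of_cap ht hxb hbm' hxm h₂ hbm
  obtain ⟨k₃, -⟩ := hF.orient_of_cap hu hxm hmc' hxc h₃ hmc
  obtain ⟨-, k₄⟩ := hF.orient_of_cap ht hx'b hbm' hx'm h₄ hbm
  obtain ⟨k₅, -⟩ := hF.orient_of_cap hu hx'm hmc' hx'c h₅ hmc
  have hx't : 0 < orient (P x) (P x') t :=
    orient_pos_trans φ (hφ x' (Ne.symm hxx')) (hφ b (Ne.symm hxb)) (hφU t ht) h₁.le k₁.le (.inl h₁)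
  have htu : 0 < orient (P x) t u :=
    orient_pos_trans φ (hφU t ht) (hφ m (Ne.symm hxm)) (hφU u hu) k₂.le k₃.le (.inl k₂)
  refine not_disjoint_segment_of_orient_pos hx't ?_ htu ?_
  · exact orient_pos_trans φ (hφ x' (Ne.symm hxx')) (hφU t ht) (hφU u hu) hx't.le htu.le (.inl hx't)
  · exact orient_pos_trans ψ (hψU t ht) (hψ m (Ne.symm hx'm)) (hψU u hu) k₄.le k₅.le (.inl k₄)

/-- A line cannot separate two opposite vertices of a convex quadrilateral from the other two:
the diagonals intersect. -/
theorem not_alternating (hF : IsConvexFrame P U) {x y z w : ι} (hxy : x < y) (hyz : y < z)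
    (hzw : z < w) (hx : 0 < orient (P x) t u) (hy : orient (P y) t u ≤ 0)
    (hz : 0 ≤ orient (P z) t u) (hw : orient (P w) t u ≤ 0) : False := by
  have key : orient (P y) (P z) (P w) * orient (P x) t u + orient (P x) (P y) (P w)
      * orient (P z) t u = orient (P x) (P z) (P w) * orient (P y) t u + orient (P x) (P y) (P z)
      * orient (P w) t u := by
    unfold orient; ring
  have h₁ := mul_pos (hF.orient_pos hyz hzw) hx
  have h₂ := mul_nonneg (hF.orient_pos hxy (hyz.trans hzw)).le hz
  have h₃ := mul_nonpos_of_nonneg_of_nonpos (hF.orient_pos (hxy.trans hyz) hzw).le hy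
  have h₄ := mul_nonpos_of_nonneg_of_nonpos (hF.orient_pos hxy hyz).le hw
  linarith

/-- If `P i`, `P j`, `P k` are seen from `t` in this order within a half-plane, then a line
through `t` cannot separate `P j` from `P i` and `P k`. -/
theorem not_separated_of_orient_pos (hF : IsConvexFrame P U) {i j k : ι} (hij : i < j) (hjk : j < k)
    (htu : t ≠ u) (h₁ : 0 < orient (P i) (P j) t) (h₂ : 0 < orient (P j) (P k) t)
    (h₃ : 0 < orient (P i) (P k) t) (hi : orient (P i) t u ≤ 0) (hj : 0 ≤ orient (P j) t u)
    (hk : orient (P k) t u ≤ 0) : False := by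
  have key : orient (P i) (P k) t * orient (P j) t u
      = orient (P j) (P k) t * orient (P i) t u + orient (P i) (P j) t * orient (P k) t u := by
    unfold orient; ring
  have k₁ := mul_nonneg h₃.le hj
  have k₂ := mul_nonpos_of_nonneg_of_nonpos h₂.le hi
  have k₃ := mul_nonpos_of_nonneg_of_nonpos h₁.le hk
  -- The signs force all three points onto the line, although they are not collinear.
  have gi : orient (P i) t u = 0 :=
    (mul_eq_zero.1 (le_antisymm k₂ (by linarith))).resolve_left h₂.ne'
  have gk : orient (P k) t u = 0 :=
    (mul_eq_zero.1 (le_antisymm k₃ (by linarith))).resolve_left h₁.ne'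
  have gj : orient (P j) t u = 0 := by
    rw [gi, gk, mul_zero, mul_zero, add_zero] at key
    exact (mul_eq_zero.1 key).resolve_left h₃.ne'
  have hD := hF.orient_pos hij hjk
  apply htu
  unfold orient at gi gj gk hD
  ext l
  fin_cases l
  · refine mul_left_cancel₀ hD.ne' ?_
    simp only [Fin.zero_eta]
    linear_combination (P j 0 - P k 0) * gi + (P k 0 - P i 0) * gj + (P i 0 - P j 0) * gk
  · refine mul_left_cancel₀ hD.ne' ?_
    simp only [Fin.mk_one]
    linear_combination (P j 1 - P k 1) * gi + (P k 1 - P i 1) * gj + (P i 1 - P j 1) * gk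

end IsConvexFrame

/-! ### Homogeneous drawings -/

/-- There are no drawings of thirteen singletons `P i` and their tripletons `q T` (for increasing
triples `T`) in a convex frame such that edges of a layer do not cross and the side of the chord
`P a`, `P b` on which `q T` lies is determined by the relative order of `a`, `b` and the elements
of `T`.

For `T = {i < j < k}`, the numbers outside `T` form the gaps `A < i < B < j < C < k < D`. The
hypotheses `AB`, `AC`, ... of the proof tell on which side of the chords between two gaps `q T` lies.
The elements of the triples used are odd, so that the even numbers represent all gaps. -/
theorem IsConvexFrame.false_of_homogeneous {P : Fin 13 → Plane} {U : Set Plane}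
    {q : (Fin 3 → Fin 13) → Plane} (hF : IsConvexFrame P U) (hq : ∀ T, StrictMono T → q T ∈ U)
    (hdis : ∀ l T T', StrictMono T → StrictMono T' → T' l ∉ Set.range T →
      Disjoint (segment ℝ (P (T l)) (q T)) (segment ℝ (P (T' l)) (q T')))
    (hom : ∀ (S : Fin 3 → Fin 5) (a b : Fin 5),
      (∀ x : Fin 5 → Fin 13, StrictMono x → 0 < orient (P (x a)) (P (x b)) (q (x ∘ S))) ∨
      (∀ x : Fin 5 → Fin 13, StrictMono x → orient (P (x a)) (P (x b)) (q (x ∘ S)) ≤ 0)) :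
    False := by
  have mono {n : ℕ} {x : Fin n → Fin 13} (h : ∀ a b, a < b → x a < x b) : StrictMono x := h
  have pos {S : Fin 3 → Fin 5} {a b : Fin 5} (h : ∀ x : Fin 5 → Fin 13, StrictMono x →
      0 < orient (P (x a)) (P (x b)) (q (x ∘ S))) (x : Fin 5 → Fin 13) {T : Fin 3 → Fin 13}
      (hx : ∀ a b, a < b → x a < x b) (hT : x ∘ S = T) : 0 < orient (P (x a)) (P (x b)) (q T) :=
    hT ▸ h x (mono hx)
  have neg {S : Fin 3 → Fin 5} {a b : Fin 5} (h : ∀ x : Fin 5 → Fin 13, StrictMono x →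
      orient (P (x a)) (P (x b)) (q (x ∘ S)) ≤ 0) (x : Fin 5 → Fin 13) {T : Fin 3 → Fin 13}
      (hx : ∀ a b, a < b → x a < x b) (hT : x ∘ S = T) : orient (P (x a)) (P (x b)) (q T) ≤ 0 :=
    hT ▸ h x (mono hx)
  have dis (l : Fin 3) (T T' : Fin 3 → Fin 13) (hT : ∀ a b, a < b → T a < T b)
      (hT' : ∀ a b, a < b → T' a < T' b) (h : ∀ m, T m ≠ T' l) :
      Disjoint (segment ℝ (P (T l)) (q T)) (segment ℝ (P (T' l)) (q T')) :=
    hdis l T T' (mono hT) (mono hT') (by rintro ⟨m, hm⟩; exact h m hm)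
  have ht : q ![1, 5, 9] ∈ U := hq _ (mono (by decide))
  have hu : q ![3, 7, 11] ∈ U := hq _ (mono (by decide))
  have hv : q ![1, 7, 9] ∈ U := hq _ (mono (by decide))
  have hw : q ![3, 5, 11] ∈ U := hq _ (mono (by decide))
  set t := q ![1, 5, 9]
  set u := q ![3, 7, 11]
  set v := q ![1, 7, 9] with hv_def
  set w := q ![3, 5, 11]
  have ort {i j k : Fin 13} (h : i < j ∧ j < k) : 0 < orient (P i) (P j) (P k) :=
    hF.orient_pos h.1 h.2
  -- A chord between adjacent gaps cuts off a single element of `T`. If the tripletons were always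
  -- beyond it, they would be close to that singleton and edges of another layer would cross.
  -- Thus they are not close to the middle singleton, ...
  rcases hom ![0, 2, 4] 1 3 with BC | BC
  swap
  · exact hF.not_disjoint_of_caps ht hu (x := 1) (x' := 3) (b := 4) (m := 6) (c := 8) (by decide)
      (ort (by decide)) (ort (by decide)) (ort (by decide)) (ort (by decide)) (ort (by decide))
      (neg BC ![1, 4, 5, 6, 9] (by decide) (by decide))
      (neg BC ![3, 6, 7, 8, 11] (by decide) (by decide))
      (dis 0 ![1, 5, 9] ![3, 7, 11] (by decide) (by decide) (by decide))
  -- ... nor to the last, ...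
  rcases hom ![0, 1, 3] 2 4 with CD | CD
  swap
  · exact hF.not_disjoint_of_caps ht hu (x := 1) (x' := 3) (b := 8) (m := 10) (c := 12) (by decide)
      (ort (by decide)) (ort (by decide)) (ort (by decide)) (ort (by decide)) (ort (by decide))
      (neg CD ![1, 5, 8, 9, 10] (by decide) (by decide))
      (neg CD ![3, 7, 10, 11, 12] (by decide) (by decide))
      (dis 0 ![1, 5, 9] ![3, 7, 11] (by decide) (by decide) (by decide))
  -- ... nor to the first.
  rcases hom ![1, 3, 4] 0 2 with AB | AB
  swap
  · have ort' {i j k : Fin 13} (h : i < j ∧ j < k) : 0 < orient (P k) (P i) (P j) := by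
      rw [← orient_rotate]; exact ort h
    have ort'' {i j k : Fin 13} (h : i < j ∧ j < k) : 0 < orient (P j) (P k) (P i) := by
      rw [orient_rotate]; exact ort h
    exact hF.not_disjoint_of_caps ht hu (x := 5) (x' := 7) (b := 0) (m := 2) (c := 4) (by decide)
      (ort'' (by decide)) (ort' (by decide)) (ort' (by decide)) (ort' (by decide))
      (ort' (by decide))
      (neg AB ![0, 1, 2, 5, 9] (by decide) (by decide))
      (neg AB ![2, 3, 4, 7, 11] (by decide) (by decide))
      (dis 1 ![1, 5, 9] ![3, 7, 11] (by decide) (by decide) (by decide))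
  -- Hence the edges from neighbouring singletons restrict the position of the line through two
  -- tripletons.
  have low : orient (P 1) t u ≤ 0 ∨ orient (P 3) t u ≤ 0 :=
    hF.orient_nonpos_or_of_disjoint ht hu (y := 0) (w := 4) (by decide) (by decide) (by decide)
      (pos AB ![0, 1, 4, 5, 9] (by decide) (by decide))
      (pos AB ![0, 3, 4, 7, 11] (by decide) (by decide))
      (dis 0 ![1, 5, 9] ![3, 7, 11] (by decide) (by decide) (by decide))
  have high : orient (P 9) t u ≤ 0 ∨ orient (P 11) t u ≤ 0 :=
    hF.orient_nonpos_or_of_disjoint ht hu (y := 8) (w := 12) (by decide) (by decide) (by decide)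
      (pos CD ![1, 5, 8, 9, 12] (by decide) (by decide))
      (pos CD ![3, 7, 8, 11, 12] (by decide) (by decide))
      (dis 2 ![1, 5, 9] ![3, 7, 11] (by decide) (by decide) (by decide))
  have low' : orient (P 1) v w ≤ 0 ∨ orient (P 3) v w ≤ 0 :=
    hF.orient_nonpos_or_of_disjoint hv hw (y := 0) (w := 4) (by decide) (by decide) (by decide)
      (pos AB ![0, 1, 4, 7, 9] (by decide) (by decide))
      (pos AB ![0, 3, 4, 5, 11] (by decide) (by decide))
      (dis 0 ![1, 7, 9] ![3, 5, 11] (by decide) (by decide) (by decide))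
  have middle' : orient (P 5) w v ≤ 0 ∨ orient (P 7) w v ≤ 0 :=
    hF.orient_nonpos_or_of_disjoint hw hv (y := 4) (w := 8) (by decide) (by decide) (by decide)
      (pos BC ![3, 4, 5, 8, 11] (by decide) (by decide))
      (pos BC ![1, 4, 7, 8, 9] (by decide) (by decide))
      (dis 1 ![3, 5, 11] ![1, 7, 9] (by decide) (by decide) (by decide))
  have high' : orient (P 9) v w ≤ 0 ∨ orient (P 11) v w ≤ 0 :=
    hF.orient_nonpos_or_of_disjoint hv hw (y := 8) (w := 12) (by decide) (by decide) (by decide)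
      (pos CD ![1, 7, 8, 9, 12] (by decide) (by decide))
      (pos CD ![3, 5, 8, 11, 12] (by decide) (by decide))
      (dis 2 ![1, 7, 9] ![3, 5, 11] (by decide) (by decide) (by decide))
  obtain ⟨i, hi, gi⟩ : ∃ i : Fin 13, (i = 1 ∨ i = 3) ∧ orient (P i) v w ≤ 0 := by
    rcases low' with h | h
    exacts [⟨1, by simp, h⟩, ⟨3, by simp, h⟩]
  obtain ⟨j, hj, gj⟩ : ∃ j : Fin 13, (j = 5 ∨ j = 7) ∧ 0 ≤ orient (P j) v w := by
    rcases middle' with h | h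
    · exact ⟨5, by simp, by rw [orient_swap_right]; linarith⟩
    · exact ⟨7, by simp, by rw [orient_swap_right]; linarith⟩
  obtain ⟨k, hk, gk⟩ : ∃ k : Fin 13, (k = 9 ∨ k = 11) ∧ orient (P k) v w ≤ 0 := by
    rcases high' with h | h
    exacts [⟨9, by simp, h⟩, ⟨11, by simp, h⟩]
  have h0i : 0 < i := by rcases hi with rfl | rfl <;> decide
  have hij : i < j := by rcases hi with rfl | rfl <;> rcases hj with rfl | rfl <;> decide
  have hjk : j < k := by rcases hj with rfl | rfl <;> rcases hk with rfl | rfl <;> decide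
  have hk12 : k < 12 := by rcases hk with rfl | rfl <;> decide
  rcases hom ![1, 2, 3] 0 4 with AD | AD
  · -- The tripletons lie beyond the chord between the last and the first singleton.
    have hvw : v ≠ w := fun h => Set.disjoint_left.1
      (dis 0 ![1, 7, 9] ![3, 5, 11] (by decide) (by decide) (by decide))
      (right_mem_segment ℝ _ _) (by rw [← hv_def, h]; exact right_mem_segment ℝ _ _)
    have h0 : 0 < orient (P 0) (P 12) v := pos AD ![0, 1, 7, 9, 12] (by decide) (by decide)
    exact hF.not_separated_of_orient_pos hij hjk hvw
      (hF.orient_pos_mono hv h0i hij (hjk.trans hk12) h0)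
      (hF.orient_pos_mono hv (h0i.trans hij) hjk hk12 h0)
      (hF.orient_pos_mono hv h0i (hij.trans hjk) hk12 h0) gi gj gk
  -- In each of the remaining cases some chords separate the two tripletons, and the line through
  -- these would have to separate four singletons in an alternating way.
  rcases hom ![1, 2, 4] 0 3 with AC | AC <;> rcases hom ![0, 2, 3] 1 4 with BD | BD
  · obtain ⟨g0, -⟩ := hF.orient_of_chord hv hw (x := 0) (y := 10) (by decide)
      (neg AD ![0, 1, 7, 9, 10] (by decide) (by decide))
      (pos AC ![0, 3, 5, 10, 11] (by decide) (by decide))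
    exact hF.not_alternating h0i hij hjk g0 gi gj gk
  · obtain ⟨g0, -⟩ := hF.orient_of_chord ht hu (x := 0) (y := 10) (by decide)
      (neg AD ![0, 1, 5, 9, 10] (by decide) (by decide))
      (pos AC ![0, 3, 7, 10, 11] (by decide) (by decide))
    obtain ⟨g4, g10⟩ := hF.orient_of_chord ht hu (x := 4) (y := 10) (by decide)
      (neg BD ![1, 4, 5, 9, 10] (by decide) (by decide))
      (pos BC ![3, 4, 7, 10, 11] (by decide) (by decide))
    rcases low with h | h
    · exact hF.not_alternating (x := 0) (y := 1) (z := 4) (w := 10) (by decide) (by decide)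
        (by decide) g0 h g4.le g10.le
    · exact hF.not_alternating (x := 0) (y := 3) (z := 4) (w := 10) (by decide) (by decide)
        (by decide) g0 h g4.le g10.le
  · obtain ⟨g2, g8⟩ := hF.orient_of_chord hu ht (x := 2) (y := 8) (by decide)
      (neg AC ![2, 3, 7, 8, 11] (by decide) (by decide))
      (pos BC ![1, 2, 5, 8, 9] (by decide) (by decide))
    obtain ⟨-, g12⟩ := hF.orient_of_chord hu ht (x := 2) (y := 12) (by decide)
      (neg AD ![2, 3, 7, 11, 12] (by decide) (by decide))
      (pos BD ![1, 2, 5, 9, 12] (by decide) (by decide))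
    rw [orient_swap_right] at high
    rw [orient_swap_right (P 11)] at high
    rcases high with h | h
    · exact hF.not_alternating (x := 2) (y := 8) (z := 9) (w := 12) (by decide) (by decide)
        (by decide) g2 g8.le (by linarith) g12.le
    · exact hF.not_alternating (x := 2) (y := 8) (z := 11) (w := 12) (by decide) (by decide)
        (by decide) g2 g8.le (by linarith) g12.le
  · obtain ⟨g0, g6⟩ := hF.orient_of_chord ht hu (x := 0) (y := 6) (by decide)
      (neg AC ![0, 1, 5, 6, 9] (by decide) (by decide))
      (pos AB ![0, 3, 6, 7, 11] (by decide) (by decide))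
    obtain ⟨g2, -⟩ := hF.orient_of_chord hu ht (x := 2) (y := 8) (by decide)
      (neg AC ![2, 3, 7, 8, 11] (by decide) (by decide))
      (pos BC ![1, 2, 5, 8, 9] (by decide) (by decide))
    obtain ⟨g4, -⟩ := hF.orient_of_chord ht hu (x := 4) (y := 10) (by decide)
      (neg BD ![1, 4, 5, 9, 10] (by decide) (by decide))
      (pos BC ![3, 4, 7, 10, 11] (by decide) (by decide))
    rw [orient_swap_right] at g2
    exact hF.not_alternating (x := 0) (y := 2) (z := 4) (w := 6) (by decide) (by decide)
      (by decide) g0 (by linarith) g4.le g6.le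

/-! ### Inner drawings -/

/-- Singletons on the boundary of a strictly convex set, numbered in clockwise order, form
a convex frame together with the interior. -/
theorem isConvexFrame_of_strictConvex {n : ℕ} {P : Fin n → Plane} {K : Set Plane}
    (hK : IsCompact K) (hKc : StrictConvex ℝ K) (hP : ∀ i, P i ∈ frontier K)
    (hinj : Function.Injective P)
    (hcw : ∀ i j k, i < j → j < k → Clockwise (P i) (P j) (P k)) :
    IsConvexFrame P (interior K) where
  orient_pos i j k hij hjk := clockwise_iff_orient_pos.1 (hcw i j k hij hjk)
  exists_support i := by
    obtain ⟨φ, hφ⟩ := geometric_hahn_banach_open_point hKc.convex.interior isOpen_interior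
      (hP i).2
    refine ⟨φ, fun j hj => ?_, hφ⟩
    have hmem : ∀ i, P i ∈ K := fun i => hK.isClosed.frontier_subset (hP i)
    -- By strict convexity the midpoint of `P i` and `P j` is an interior point.
    have hmid := hφ _ (hKc (hmem i) (hmem j) (fun h => hj (hinj h).symm)
      (by norm_num : (0 : ℝ) < 1 / 2) (by norm_num : (0 : ℝ) < 1 / 2) (by norm_num))
    simp only [map_add, map_smul, smul_eq_mul] at hmid
    linarith

/-- The tripleton of the singletons whose numbers form the increasing triple `T`. -/
def tripleton {n : ℕ} (num : Fin n ≃ Fin n) (T : Fin 3 → Fin n) (hT : StrictMono T) :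
    G3Vertex n :=
  ⟨Finset.univ.image (num.symm ∘ T), .inr (by
    rw [Finset.card_image_of_injective _ (num.symm.injective.comp hT.injective),
      Finset.card_fin])⟩

theorem card_tripleton {n : ℕ} (num : Fin n ≃ Fin n) {T : Fin 3 → Fin n} (hT : StrictMono T) :
    (tripleton num T hT).1.card = 3 := by
  rw [tripleton, Finset.card_image_of_injective _ (num.symm.injective.comp hT.injective),
    Finset.card_fin]

theorem mem_tripleton {n : ℕ} {num : Fin n ≃ Fin n} {T : Fin 3 → Fin n} {hT : StrictMono T}
    {i : Fin n} : i ∈ (tripleton num T hT).1 ↔ ∃ m, num.symm (T m) = i := by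
  simp [tripleton]

theorem single_injective {n : ℕ} : Function.Injective (single : Fin n → G3Vertex n) :=
  fun _ _ h => Finset.singleton_injective (congrArg Subtype.val h)

theorem single_ne_tripleton {n : ℕ} (num : Fin n ≃ Fin n) {T : Fin 3 → Fin n} (hT : StrictMono T)
    (i : Fin n) : single i ≠ tripleton num T hT := fun h => by
  have := card_tripleton num hT
  rw [← h] at this
  simp [single] at this

/-- The edge from a tripleton to its singleton with the `l`-th smallest number lies in
the `l`-th layer of a coherent drawing. -/
theorem edge_mem_layer {n : ℕ} (num : Fin n ≃ Fin n) {T : Fin 3 → Fin n} (hT : StrictMono T)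
    (l : Fin 3) : s(single (num.symm (T l)), tripleton num T hT) ∈
      ![lowEdges num, middleEdges num, highEdges num] l := by
  have hcard := card_tripleton num hT
  have hmem : ∀ m, num.symm (T m) ∈ (tripleton num T hT).1 := fun m => mem_tripleton.2 ⟨m, rfl⟩
  fin_cases l
  · refine ⟨_, _, hcard, hmem 0, rfl, fun j hj => ?_⟩
    obtain ⟨m, rfl⟩ := mem_tripleton.1 hj
    simpa using hT.monotone (Fin.zero_le m)
  · exact ⟨_, _, hcard, hmem 1, rfl, ⟨_, hmem 0, by simpa using hT (by decide : (0 : Fin 3) < 1)⟩,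
      ⟨_, hmem 2, by simpa using hT (by decide : (1 : Fin 3) < 2)⟩⟩
  · refine ⟨_, _, hcard, hmem 2, rfl, fun j hj => ?_⟩
    obtain ⟨m, rfl⟩ := mem_tripleton.1 hj
    simpa using hT.monotone (Fin.le_last m)

theorem edgeSegment_mk {V : Type*} (pos : V → Plane) (a b : V) :
    edgeSegment pos s(a, b) = segment ℝ (pos a) (pos b) := by
  rw [edgeSegment, ← convexHull_pair]
  congr 1
  ext x
  simp [eq_comm]

/-- Edges of a layer without a common end are disjoint segments. -/
theorem disjoint_segment_of_isConvexDrawing {n : ℕ} {pos : G3Vertex n → Plane}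
    {num : Fin n ≃ Fin n}
    (h : IsConvexDrawing pos ![lowEdges num, middleEdges num, highEdges num]) (l : Fin 3)
    {T T' : Fin 3 → Fin n} (hT : StrictMono T) (hT' : StrictMono T') (hl : T' l ∉ Set.range T) :
    Disjoint (segment ℝ (pos (single (num.symm (T l)))) (pos (tripleton num T hT)))
      (segment ℝ (pos (single (num.symm (T' l)))) (pos (tripleton num T' hT'))) := by
  have hne : tripleton num T hT ≠ tripleton num T' hT' := fun h => by
    have : num.symm (T' l) ∈ (tripleton num T hT).1 := by rw [h]; exact mem_tripleton.2 ⟨l, rfl⟩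
    obtain ⟨m, hm⟩ := mem_tripleton.1 this
    exact hl ⟨m, num.symm.injective hm⟩
  have hends : ∀ r, r ∈ s(single (num.symm (T l)), tripleton num T hT) →
      r ∉ s(single (num.symm (T' l)), tripleton num T' hT') := by
    intro r hr hr'
    rcases Sym2.mem_iff.1 hr with rfl | rfl <;> rcases Sym2.mem_iff.1 hr' with h | h
    · exact hl ⟨l, num.symm.injective (single_injective h)⟩
    · exact single_ne_tripleton num hT' _ h
    · exact single_ne_tripleton num hT _ h.symm
    · exact hne h
  rw [← edgeSegment_mk, ← edgeSegment_mk, Set.disjoint_iff]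
  refine (h.noncrossing l _ (edge_mem_layer num hT l) _ (edge_mem_layer num hT' l)
    fun he => hends _ (Sym2.mem_mk_right _ _) (he ▸ Sym2.mem_mk_right _ _)).trans ?_
  rintro _ ⟨r, ⟨hr, hr'⟩, rfl⟩
  exact hends r hr hr'

theorem mainTheorem3 :
    ∃ n₃ : ℕ, 0 < n₃ ∧ ¬ ∃ pos : G3Vertex n₃ → Plane, IsInnerDrawing pos := by
  classical
  -- An increasing quintuple is coloured by the sides of all chords with respect to all tripletons
  -- that are formed by its members.
  obtain ⟨N, hN, hR⟩ := exists_homogeneous_orderEmbedding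
    (κ := (Fin 3 → Fin 5) × Fin 5 × Fin 5 → Prop) 5 13
  refine ⟨N, hN, ?_⟩
  rintro ⟨pos, ⟨num, hcw, hconv⟩, C, U, ⟨K, hK, hKc, -, rfl, rfl⟩, hC, hU⟩
  obtain ⟨P, hP⟩ : ∃ P : Fin N → Plane, ∀ i, P i = pos (single (num.symm i)) := ⟨_, fun _ => rfl⟩
  -- The value of `q` at triples that are not increasing is irrelevant.
  obtain ⟨q, hq⟩ : ∃ q : (Fin 3 → Fin N) → Plane, ∀ T hT, q T = pos (tripleton num T hT) :=
    ⟨fun T => if hT : StrictMono T then pos (tripleton num T hT) else 0, fun T hT => dif_pos hT⟩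
  have hF : IsConvexFrame P (interior K) := by
    refine isConvexFrame_of_strictConvex hK hKc (fun i => hP i ▸ hC _) (fun i j h => ?_)
      (fun i j k hij hjk => ?_)
    · rw [hP, hP] at h
      exact num.symm.injective (single_injective (hconv.injective h))
    · rw [hP, hP, hP]
      exact hcw _ _ _ (by simpa using hij) (by simpa using hjk)
  obtain ⟨g, c, hg⟩ := hR fun x S => 0 < orient (P (x S.2.1)) (P (x S.2.2)) (q (x ∘ S.1))
  refine IsConvexFrame.false_of_homogeneous (P := P ∘ g) (U := interior K) (q := fun T => q (g ∘ T))
    ⟨fun i j k hij hjk => hF.orient_pos (g.strictMono hij) (g.strictMono hjk), fun i => ?_⟩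
    (fun T hT => ?_) (fun l T T' hT hT' hl => ?_) (fun S a b => ?_)
  · obtain ⟨φ, hφ, hφU⟩ := hF.exists_support (g i)
    exact ⟨φ, fun j hj => hφ _ fun h => hj (g.injective h), hφU⟩
  · rw [hq _ (g.strictMono.comp hT)]
    exact hU _ (card_tripleton num _)
  · rw [hq _ (g.strictMono.comp hT), hq _ (g.strictMono.comp hT'), Function.comp_apply,
      Function.comp_apply, hP, hP]
    refine disjoint_segment_of_isConvexDrawing hconv l (g.strictMono.comp hT)
      (g.strictMono.comp hT') ?_
    rintro ⟨m, hm⟩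
    exact hl ⟨m, g.injective hm⟩
  · have hgS := fun x hx => congrFun (hg x hx) (S, a, b)
    by_cases h : c (S, a, b)
    · exact .inl fun x hx => (hgS x hx).mpr h
    · exact .inr fun x hx => not_lt.1 fun h' => h ((hgS x hx).mp h')
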